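/- For a finite group $G$, the enhanced power graph $\mathcal{G}_E(G)$ has vertex set $G$, two distinct elements being adjacent if and only if both lie in $\langle w\rangle$ for some $w\in G$; the proper enhanced power graph $\mathcal{G}_E^{**}(G)$ is obtained from it by deleting all dominating vertices (those adjacent to every other vertex). The strong domination number $\gamma^{\text{strong}}(\Gamma)$ of a graph $\Gamma$ is the least size of a set $D$ of vertices such that every vertex of $\Gamma$ (including those in $D$) has a neighbour in $D$. For $k\ge 3$ let $Q_{2^k}$ be the generalized quaternion group of order $2^k$. Let $G$ be a finite nilpotent group whose Sylow $2$-subgroup is isomorphic to $Q_{2^k}$, $k\geq 3$. Below, $n$ is a positive integer, and $G_1$ is a nontrivial finite nilpotent group such that for every prime $p$ dividing $|G_1|$ the Sylow $p$-subgroup of $G_1$ is neither cyclic nor generalized quaternion; $r_1$ is the minimum, over the primes $p$ dividing $|G_1|$, of the number of subgroups of order $p$ in the Sylow $p$-subgroup of $G_1$. Then $G\cong \mathbb{Z}_n\times Q_{2^k}$ or $G\cong G_1\times\mathbb{Z}_n\times Q_{2^k}$ for some $n$ and $G_1$ as above ($n=1$ allowed) with the orders of the factors pairwise coprime, and \[ \gamma^{\text{strong}}(\mathcal{G}_E^{**}(G))=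 \begin{cases} 2^{k-1}+2, & \text{if } G\cong Q_{2^k}, \text{ or } G\cong\mathbb{Z}_n\times Q_{2^k} \text{ with } \gcd(n,2)=1,\\ \min\{r_1,\,2^{k-2}+1\}+1, & \text{if } G\cong G_1\times Q_{2^k} \text{ with } \gcd(|G_1|,2)=1, \text{ or}\\ & G\cong G_1\times\mathbb{Z}_n\times Q_{2^k} \text{ with } \gcd(|G_1|,n)=\gcd(|G_1|,2)=\gcd(n,2)=1. \end{cases} \] -/

import Mathlib

universe u v

namespace EnhancedPower

/-- The enhanced power graph of a group: distinct `x`, `y` are adjacent iff both lie in a common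
cyclic subgroup `⟨w⟩`. -/
def enhancedPowerGraph (G : Type u) [Group G] : SimpleGraph G where
  Adj x y := x ≠ y ∧ ∃ w : G, x ∈ Subgroup.zpowers w ∧ y ∈ Subgroup.zpowers w
  symm := ⟨fun _ _ h => ⟨h.1.symm, h.2.imp fun _ hw => ⟨hw.2, hw.1⟩⟩⟩
  loopless := ⟨fun _ h => h.1 rfl⟩

/-- A dominating vertex is adjacent to every other vertex. -/
def IsDominatingVertex {V : Type u} (Γ : SimpleGraph V) (x : V) : Prop :=
  ∀ y : V, y ≠ x → Γ.Adj x y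

/-- The proper enhanced power graph: all dominating vertices are deleted. -/
def properEnhancedPowerGraph (G : Type u) [Group G] :
    SimpleGraph {x : G | ¬ IsDominatingVertex (enhancedPowerGraph G) x} :=
  (enhancedPowerGraph G).induce {x : G | ¬ IsDominatingVertex (enhancedPowerGraph G) x}

/-- A strongly dominating (total dominating) set: every vertex of the graph, including those of
`D`, has a neighbour in `D`. -/
def IsStronglyDominating {V : Type u} (Γ : SimpleGraph V) (D : Set V) : Prop :=
  ∀ x : V, ∃ y ∈ D, Γ.Adj x y

/-- The least size of a finite strongly dominating set. The value `0` is taken only if the graph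
has no vertices or no finite strongly dominating set, so that a positive value is attained. -/
noncomputable def strongDominationNumber {V : Type u} (Γ : SimpleGraph V) : ℕ :=
  sInf {t : ℕ | ∃ D : Finset V, IsStronglyDominating Γ (D : Set V) ∧ D.card = t}

/-- The generalized quaternion group of order `2 ^ k`, for `k ≥ 3`
(`QuaternionGroup m` has order `4 * m`). -/
abbrev GenQuaternion (k : ℕ) : Type := QuaternionGroup (2 ^ (k - 2))

/-- `G` is a generalized quaternion group `Q_{2^k}`, `k ≥ 3`. -/
def IsGenQuaternion (G : Type u) [Group G] : Prop :=
  ∃ k : ℕ, 3 ≤ k ∧ Nonempty (G ≃* GenQuaternion k)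

/-- A nontrivial finite nilpotent group none of whose (nontrivial) Sylow subgroups is cyclic or
generalized quaternion. -/
structure IsNoncyclicPart (G₁ : Type u) [Group G₁] : Prop where
  finite : Finite G₁
  nontrivial : Nontrivial G₁
  nilpotent : Group.IsNilpotent G₁
  sylow : ∀ p : ℕ, p.Prime → p ∣ Nat.card G₁ → ∀ P : Sylow p G₁,
    ¬ IsCyclic P ∧ ¬ IsGenQuaternion P

/-- The number of subgroups of order `q`. -/
noncomputable def numSubgroups (G : Type u) [Group G] (q : ℕ) : ℕ :=
  Nat.card {H : Subgroup G // Nat.card H = q}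

/-- The least, over the primes `p` dividing `|G₁|`, of the number of subgroups of order `p`
of a Sylow `p`-subgroup of `G₁`. -/
noncomputable def minNumPrimeSubgroups (G₁ : Type u) [Group G₁] : ℕ :=
  sInf {r : ℕ | ∃ p : ℕ, p.Prime ∧ p ∣ Nat.card G₁ ∧ ∃ P : Sylow p G₁, r = numSubgroups P p}

end EnhancedPower

/-! Adjacent elements are distinct elements forming a cyclic pair, that is, lying in a common cyclic
subgroup. For factors of coprime orders this is decided componentwise (`cyclicPair_prod_iff`), so a
cyclic factor is invisible and only `G₁` and the quaternion group matter. Put `m = 2 ^ (k - 2)`. In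
the quaternion group the centre is paired with everything, and the noncentral elements fall into `m
+ 1` classes, one for each maximal cyclic subgroup (`cyclicPair_quaternion_iff`).

Without `G₁` the proper graph is a disjoint union of `m + 1` cliques. A strongly dominating set
needs two vertices in each, which gives `2 * (m + 1)`.

With `G₁` two constructions compete: generators of all subgroups of one prime order `p` in `G₁`, or
representatives of all quaternion classes. In either case one extra vertex from the other factor is
a neighbour of the chosen vertices themselves. Elements of order `p` in `G₁` are indeed vertices,
because an odd `p`-group with a single subgroup of order `p` is cyclic
(`isCyclic_of_unique_prime_order`).

Conversely, a strongly dominating set `D` contains two adjacent vertices. If it is smaller than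
claimed, counting shows that it misses a quaternion class and, for every prime `q` dividing `|G₁|`,
a subgroup of order `q`. Nilpotency puts all the missed subgroups into one `⟨h⟩`, and `h` paired
with a representative of the missed class has no neighbour in `D`. -/

namespace EnhancedPower

/-! ### Odd `p`-groups with a unique subgroup of order `p` -/

theorem mul_pow_of_central_commutator {P : Type*} [Group P] {x y c : P}
    (hc : c ∈ Subgroup.center P) (h : y * x = x * y * c) (n : ℕ) :
    (x * y) ^ n = x ^ n * y ^ n * c ^ n.choose 2 := by
  have hcc : ∀ (g : P) (i : ℕ), c ^ i * g = g * c ^ i := fun g i =>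
    have hg : Commute g c := Subgroup.mem_center_iff.mp hc g
    (hg.pow_right i).eq.symm
  have hy : ∀ i : ℕ, y ^ i * x = x * y ^ i * c ^ i := by
    intro i
    induction i with
    | zero => simp
    | succ i ih =>
      have h1 := hcc y i
      calc y ^ (i + 1) * x = y ^ i * (y * x) := by group
        _ = (y ^ i * x) * y * c := by rw [h]; group
        _ = x * y ^ i * (c ^ i * y) * c := by rw [ih]; group
        _ = x * y ^ (i + 1) * c ^ (i + 1) := by rw [h1]; simp only [pow_succ, mul_assoc]
  induction n with
  | zero => simp
  | succ n ih =>
    rw [pow_succ, ih, Nat.choose_succ_succ' n 1, Nat.choose_one_right]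
    calc x ^ n * y ^ n * c ^ n.choose 2 * (x * y)
        = x ^ n * y ^ n * (c ^ n.choose 2 * (x * y)) := by group
      _ = x ^ n * (y ^ n * x) * y * c ^ n.choose 2 := by rw [hcc]; simp only [mul_assoc]
      _ = x ^ n * x * y ^ n * (c ^ n * y) * c ^ n.choose 2 := by
        rw [hy]; simp only [mul_assoc]
      _ = _ := by
        rw [hcc, pow_add c]; simp only [pow_succ, mul_assoc]

/-- In a noncyclic group of least order all index `p` subgroups are cyclic. An element `x` outside
such a `K` can be corrected by some `y ∈ K` so that `(x * y) ^ p = 1`; uniqueness then forces `x * y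
∈ K`, a contradiction. Oddness makes `p` divide `p.choose 2`. -/
theorem isCyclic_of_unique_prime_order {p : ℕ} (hp : p.Prime) (hp2 : p ≠ 2) (N : ℕ) :
    ∀ (P : Type u) [Group P] [Finite P], Nat.card P = p ^ N →
    (∀ x y : P, x ^ p = 1 → y ^ p = 1 → x ≠ 1 → y ∈ Subgroup.zpowers x) → IsCyclic P := by
  have := Fact.mk hp
  induction N with
  | zero =>
    intro P _ _ hcard _
    have : Subsingleton P := (Nat.card_eq_one_iff_unique.mp (by simpa using hcard)).1
    infer_instance
  | succ n ih =>
    intro P _ _ hcard hU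
    by_contra hnc
    have ihS : ∀ K : Subgroup P, Nat.card K = p ^ n → IsCyclic K := by
      intro K hK
      refine ih K hK fun x y hx hy hx1 => ?_
      obtain ⟨i, hi⟩ := hU x y (by exact_mod_cast congrArg Subtype.val hx)
        (by exact_mod_cast congrArg Subtype.val hy) (by simpa using hx1)
      exact ⟨i, Subtype.ext (by simpa using hi)⟩
    have hnormal : ∀ K : Subgroup P, Nat.card K = p ^ n → K.Normal ∧ K.index = p := by
      intro K hK
      have h1 : K.index = p := by
        have h := K.card_mul_index
        rw [hK, hcard, pow_succ] at h
        exact Nat.eq_of_mul_eq_mul_left (pow_pos hp.pos n) h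
      refine ⟨Subgroup.normal_of_index_eq_minFac_card ?_, h1⟩
      rw [h1, hcard, hp.pow_minFac (Nat.succ_ne_zero n)]
    have hpow : ∀ K : Subgroup P, Nat.card K = p ^ n → ∀ g : P, g ^ p ∈ K := by
      intro K hK g
      obtain ⟨h1, h2⟩ := hnormal K hK
      have := K.pow_index_mem g
      rwa [h2] at this
    have hmax : ∀ x : P, ∃ K : Subgroup P, Nat.card K = p ^ n ∧ x ∈ K := by
      intro x
      obtain ⟨i, hi, hi'⟩ := (Nat.dvd_prime_pow hp).mp (hcard ▸ orderOf_dvd_natCard x)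
      have hin : i ≤ n := by
        by_contra hlt
        have : i = n + 1 := by omega
        exact hnc (isCyclic_of_orderOf_eq_card x (by rw [hi', hcard, this]))
      obtain ⟨K, hK, hK'⟩ := Sylow.exists_subgroup_card_pow_prime_le p
        (hcard ▸ pow_dvd_pow p (Nat.le_succ n)) (Subgroup.zpowers x)
        (by rw [Nat.card_zpowers, hi']) hin
      exact ⟨K, hK, hK' (Subgroup.mem_zpowers x)⟩
    obtain ⟨K, hK, -⟩ := hmax 1
    have hn0 : n ≠ 0 := by
      rintro rfl
      exact hnc (isCyclic_of_prime_card (p := p) (by simpa using hcard))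
    obtain ⟨⟨a, haK⟩, ha⟩ := (ihS K hK).exists_generator
    have haK' : Subgroup.zpowers a = K := by
      apply le_antisymm (by simpa using haK)
      intro z hz
      obtain ⟨i, hi⟩ := ha ⟨z, hz⟩
      exact ⟨i, by simpa using congrArg Subtype.val hi⟩
    have hKne : K ≠ ⊤ := by
      rintro rfl
      rw [Subgroup.card_top, hcard] at hK
      exact absurd (Nat.pow_right_injective hp.two_le hK) (by omega)
    obtain ⟨x, hx⟩ : ∃ x, x ∉ K := by
      by_contra! h
      exact hKne (eq_top_iff.mpr fun z _ => h z)
    obtain ⟨M, hM, hxM⟩ := hmax x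
    have hcomm : Commute x (a ^ p) := by
      have := ihS M hM
      let _ := IsCyclic.commGroup (α := M)
      exact congrArg Subtype.val (mul_comm (⟨x, hxM⟩ : M) ⟨a ^ p, hpow M hM a⟩)
    obtain ⟨t, ht⟩ : x ^ p ∈ Subgroup.zpowers a := haK' ▸ hpow K hK x
    have hat : orderOf a = p ^ n := by rw [← Nat.card_zpowers, haK', hK]
    -- If `t` were prime to `p`, then `a` would be a power of `x ^ p`, so `K ≤ M`, hence `K = M`
    -- would contain `x`.
    obtain ⟨j, rfl⟩ : (p : ℤ) ∣ t := by
      by_contra hpt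
      have hcop : IsCoprime t ((p ^ n : ℕ) : ℤ) := by
        push_cast
        exact (((Nat.prime_iff_prime_int.mp hp).coprime_iff_not_dvd.mpr hpt).symm).pow_right
      obtain ⟨r, s, hrs⟩ := hcop
      have h1 : a ∈ Subgroup.zpowers x := by
        have : a = (x ^ p) ^ r := by
          have ht' : x ^ p = a ^ t := ht.symm
          rw [ht', ← zpow_mul]
          conv_lhs => rw [← zpow_one a, ← hrs, zpow_add, mul_comm s, zpow_mul a _ s,
            zpow_natCast, ← hat, pow_orderOf_eq_one, one_zpow, mul_one, mul_comm r]
        rw [this]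
        exact zpow_mem (pow_mem (Subgroup.mem_zpowers x) p) r
      have h2 : K ≤ M := by
        rw [← haK']
        have : Subgroup.zpowers x ≤ M := by simpa using hxM
        simpa using this h1
      exact hx (Subgroup.eq_of_le_of_card_ge h2 (by rw [hM, hK]) ▸ hxM)
    -- This choice makes `y ^ p` the inverse of `x ^ p`.
    set y : P := a ^ (-j) with hy
    have hyK : y ∈ K := zpow_mem haK _
    have hyp : y ^ p = (a ^ p) ^ (-j) := by
      rw [hy, ← zpow_natCast, ← zpow_natCast, ← zpow_mul, ← zpow_mul, mul_comm]
    have hcy : Commute x (y ^ p) := by rw [hyp]; exact hcomm.zpow_right _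
    set c : P := y⁻¹ * (x⁻¹ * y * x) with hc
    have hKn := (hnormal K hK).1
    have hbK : x⁻¹ * y * x ∈ K := by simpa using hKn.conj_mem y hyK x⁻¹
    have hcp : c ^ p = 1 := by
      have hcomK : Commute y⁻¹ (x⁻¹ * y * x) := by
        have := ihS K hK
        let _ := IsCyclic.commGroup (α := K)
        exact congrArg Subtype.val (mul_comm (⟨y⁻¹, inv_mem hyK⟩ : K) ⟨_, hbK⟩)
      rw [hc, hcomK.mul_pow]
      have : (x⁻¹ * y * x) ^ p = x⁻¹ * y ^ p * x := by
        simpa using (conj_pow (i := p) (a := x⁻¹) (b := y))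
      rw [this, mul_assoc x⁻¹, ← hcy.eq]
      simp
    have hPp : IsPGroup p P := IsPGroup.of_card hcard
    have hPnt : Nontrivial P := by
      rw [← Finite.one_lt_card_iff_nontrivial, hcard]
      exact Nat.one_lt_pow (Nat.succ_ne_zero n) hp.one_lt
    -- The centre of a nontrivial `p`-group contains an element of order `p`, hence the unique
    -- subgroup of that order.
    have hcen : c ∈ Subgroup.center P := by
      have hcn := hPp.center_nontrivial
      have hd : p ∣ Nat.card (Subgroup.center P) := by
        obtain ⟨m, hm0, hm⟩ := (IsPGroup.nontrivial_iff_card (hPp.to_subgroup _)).mp hcn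
        rw [hm]; exact dvd_pow_self p hm0.ne'
      obtain ⟨z, hz⟩ := exists_prime_orderOf_dvd_card' p hd
      have hz1 : (z : P) ≠ 1 := by
        intro h
        have : z = 1 := Subtype.ext h
        rw [this, orderOf_one] at hz
        exact hp.one_lt.ne hz
      have hzp : (z : P) ^ p = 1 := by
        have := pow_orderOf_eq_one z
        rw [hz] at this
        exact_mod_cast congrArg Subtype.val this
      have := hU z c hzp hcp hz1
      exact (Subgroup.zpowers_le.mpr z.2) this
    have hxy : (x * y) ^ p = 1 := by
      rw [mul_pow_of_central_commutator hcen (y := y) (by rw [hc]; group) p]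
      obtain ⟨e, he⟩ := hp.dvd_choose_self (k := 2) (by norm_num)
        (lt_of_le_of_ne hp.two_le (Ne.symm hp2))
      rw [he, pow_mul, hcp, one_pow, mul_one, ← ht, hyp, ← zpow_natCast a p, ← zpow_mul]
      simp
    obtain ⟨z, hz⟩ := exists_prime_orderOf_dvd_card' (G := K) p
      (by rw [hK]; exact dvd_pow_self p hn0)
    have hz1 : (z : P) ≠ 1 := by
      intro h
      have : z = 1 := Subtype.ext h
      rw [this, orderOf_one] at hz
      exact hp.one_lt.ne hz
    have hzp : (z : P) ^ p = 1 := by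
      have := pow_orderOf_eq_one z
      rw [hz] at this
      exact_mod_cast congrArg Subtype.val this
    have h3 : x * y ∈ K := (Subgroup.zpowers_le.mpr z.2) (hU z (x * y) hzp hxy hz1)
    exact hx ((Subgroup.mul_mem_cancel_right K hyK).mp h3)

/-! ### Decomposition of finite nilpotent groups -/

theorem exists_mulEquiv_pi_isPGroup (G : Type u) [Group G] [Finite G] [Group.IsNilpotent G] :
    ∃ (X : (Nat.card G).primeFactors → Type u) (_ : ∀ p, Group (X p)),
      (∀ p, Finite (X p) ∧ IsPGroup p (X p)) ∧ Nonempty (G ≃* ∀ p, X p) := by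
  have hn : ∀ {p : ℕ} [Fact p.Prime] (P : Sylow p G), P.Normal := fun P => inferInstance
  -- The factor at `p` is a product over all Sylow `p`-subgroups; normality leaves only one.
  refine ⟨fun p => ∀ P : Sylow p G, P, fun p => inferInstance, fun p => ?_,
    ⟨(Sylow.directProductOfNormal hn).symm⟩⟩
  have := Fact.mk (Nat.prime_of_mem_primeFactors p.2)
  refine ⟨inferInstance, fun x => ?_⟩
  let P : Sylow p G := default
  have := Sylow.unique_of_normal P (hn P)
  obtain ⟨k, hk⟩ := P.isPGroup' (x P)
  refine ⟨k, funext fun Q => ?_⟩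
  obtain rfl := Subsingleton.elim P Q
  exact hk

/-- In each Sylow factor both components have `p`-power order, so coprimality makes one of them
trivial. -/
theorem commute_of_coprime_orderOf {G : Type u} [Group G] [Finite G] [Group.IsNilpotent G]
    {x y : G} (h : (orderOf x).Coprime (orderOf y)) : Commute x y := by
  obtain ⟨X, _, hX, ⟨e⟩⟩ := exists_mulEquiv_pi_isPGroup G
  suffices hs : Commute (e x) (e y) by
    exact e.injective (by simpa using hs.eq)
  refine funext fun p => ?_
  have hp := Nat.prime_of_mem_primeFactors p.2
  have := Fact.mk hp
  obtain ⟨i, hi⟩ := (IsPGroup.iff_orderOf.mp (hX p).2) (e x p)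
  obtain ⟨j, hj⟩ := (IsPGroup.iff_orderOf.mp (hX p).2) (e y p)
  have hdvd : ∀ z : G, orderOf (e z p) ∣ orderOf z := fun z =>
    orderOf_map_dvd ((Pi.evalMonoidHom X p).comp e.toMonoidHom) z
  have hc : (orderOf (e x p)).Coprime (orderOf (e y p)) :=
    (h.coprime_dvd_left (hdvd x)).coprime_dvd_right (hdvd y)
  rw [hi, hj] at hc
  change e x p * e y p = e y p * e x p
  rcases Nat.eq_zero_or_pos i with rfl | hi0
  · rw [orderOf_eq_one_iff.mp (hi.trans (pow_zero _))]; simp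
  rcases Nat.eq_zero_or_pos j with rfl | hj0
  · rw [orderOf_eq_one_iff.mp (hj.trans (pow_zero _))]; simp
  exact absurd ((Nat.coprime_pow_left_iff hi0 _ _).mp ((Nat.coprime_pow_right_iff hj0 _ _).mp hc))
    (by simpa using hp.ne_one)

theorem exists_mulEquiv_prod (G : Type u) [Group G] [Finite G] [Group.IsNilpotent G]
    (π : ℕ → Prop) :
    ∃ (A B : Type u) (_ : Group A) (_ : Group B), Finite A ∧ Finite B ∧
      (∀ p : ℕ, p.Prime → p ∣ Nat.card A → π p) ∧ (∀ p : ℕ, p.Prime → p ∣ Nat.card B → ¬ π p) ∧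
      Nonempty (G ≃* A × B) := by
  classical
  obtain ⟨X, _, hX, ⟨e⟩⟩ := exists_mulEquiv_pi_isPGroup G
  have := fun p => (hX p).1
  have key : ∀ (ρ : (Nat.card G).primeFactors → Prop) (q : ℕ), q.Prime →
      q ∣ Nat.card (∀ p : {p // ρ p}, X p) → ∃ p, ρ p ∧ p.1 = q := by
    intro ρ q hq hd
    rw [Nat.card_pi, (Nat.prime_iff.mp hq).dvd_finsetProd_iff] at hd
    obtain ⟨p, -, hp⟩ := hd
    refine ⟨p.1, p.2, ?_⟩
    have hpp := Nat.prime_of_mem_primeFactors p.1.2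
    have := Fact.mk hpp
    obtain ⟨n, hn⟩ := IsPGroup.iff_card.mp (hX p.1).2
    rw [hn] at hp
    exact ((Nat.prime_dvd_prime_iff_eq hq hpp).mp (hq.dvd_of_dvd_pow hp)).symm
  refine ⟨∀ p : {p : (Nat.card G).primeFactors // π p}, X p,
    ∀ p : {p : (Nat.card G).primeFactors // ¬ π p}, X p, inferInstance, inferInstance,
    inferInstance, inferInstance, ?_, ?_, ⟨e.trans
      { Equiv.piEquivPiSubtypeProd (fun p : (Nat.card G).primeFactors => π p) X with
        map_mul' := fun _ _ => rfl }⟩⟩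
  · intro q hq hd
    obtain ⟨p, h1, rfl⟩ := key _ q hq hd
    exact h1
  · intro q hq hd
    obtain ⟨p, h1, rfl⟩ := key _ q hq hd
    exact h1

/-- The Sylow `p`-subgroups of `A` are those of `A × B` if `p` does not divide the order of `B`. -/
theorem nonempty_sylow_mulEquiv {G A B : Type*} [Group G] [Group A] [Group B] [Finite A] [Finite B]
    (e : G ≃* A × B) {p : ℕ} (hp : p.Prime) (hB : ¬ p ∣ Nat.card B) (P : Sylow p A)
    (S : Sylow p G) : Nonempty (P ≃* S) := by
  have := Fact.mk hp
  have : Finite G := Finite.of_equiv _ e.symm.toEquiv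
  let f : A →* G := e.symm.toMonoidHom.comp (MonoidHom.inl A B)
  have hf : Function.Injective f :=
    e.symm.injective.comp (fun x y h => (Prod.ext_iff.mp h).1)
  have hcard : Nat.card (P.1.map f) = p ^ (Nat.card G).factorization p := by
    rw [Nat.card_congr (P.1.equivMapOfInjective f hf).symm.toEquiv, Nat.card_congr e.toEquiv,
      Nat.card_prod, Nat.factorization_mul Nat.card_pos.ne' Nat.card_pos.ne',
      Finsupp.add_apply, Nat.factorization_eq_zero_of_not_dvd hB, add_zero]
    exact P.card_eq_multiplicity
  exact ⟨(P.1.equivMapOfInjective f hf).trans ((Sylow.ofCard _ hcard).equiv S)⟩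

/-! ### Pairs of elements in a common cyclic subgroup -/

/-- `x` and `y` lie in a common cyclic subgroup. -/
def CyclicPair {G : Type*} [Group G] (x y : G) : Prop :=
  ∃ w : G, x ∈ Subgroup.zpowers w ∧ y ∈ Subgroup.zpowers w

section CyclicPair

variable {G H : Type*} [Group G] [Group H]

theorem CyclicPair.symm {x y : G} (h : CyclicPair x y) : CyclicPair y x :=
  h.imp fun _ hw => ⟨hw.2, hw.1⟩

theorem cyclicPair_self (x : G) : CyclicPair x x :=
  ⟨x, Subgroup.mem_zpowers x, Subgroup.mem_zpowers x⟩

theorem cyclicPair_of_mem_zpowers {x y : G} (h : y ∈ Subgroup.zpowers x) : CyclicPair x y :=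
  ⟨x, Subgroup.mem_zpowers x, h⟩

theorem cyclicPair_one_left (x : G) : CyclicPair 1 x :=
  ⟨x, one_mem _, Subgroup.mem_zpowers x⟩

theorem cyclicPair_one_right (x : G) : CyclicPair x 1 :=
  (cyclicPair_one_left x).symm

theorem cyclicPair_of_isCyclic [IsCyclic G] (x y : G) : CyclicPair x y := by
  obtain ⟨w, hw⟩ := IsCyclic.exists_generator (α := G)
  exact ⟨w, hw x, hw y⟩

theorem CyclicPair.map {x y : G} (f : G →* H) (h : CyclicPair x y) : CyclicPair (f x) (f y) := by
  obtain ⟨w, ⟨i, rfl⟩, ⟨j, rfl⟩⟩ := h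
  exact ⟨f w, ⟨i, (map_zpow f w i).symm⟩, ⟨j, (map_zpow f w j).symm⟩⟩

theorem cyclicPair_map_iff (e : G ≃* H) {x y : G} :
    CyclicPair (e x) (e y) ↔ CyclicPair x y :=
  ⟨fun h => by simpa using h.map e.symm.toMonoidHom, fun h => h.map e.toMonoidHom⟩

/-- The power with exponent `orderOf y` kills `y`, and still generates `⟨x⟩`. -/
theorem mem_zpowers_mul_of_coprime {x y : G} (hc : Commute x y)
    (h : (orderOf x).Coprime (orderOf y)) : x ∈ Subgroup.zpowers (x * y) := by
  obtain ⟨m, hm⟩ := exists_pow_eq_self_of_coprime h.symm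
  refine ⟨(orderOf y * m : ℕ), ?_⟩
  change (x * y) ^ ((orderOf y * m : ℕ) : ℤ) = x
  rw [zpow_natCast, pow_mul, hc.mul_pow, pow_orderOf_eq_one, mul_one, hm]

theorem cyclicPair_of_coprime {x y : G} (hc : Commute x y)
    (h : (orderOf x).Coprime (orderOf y)) : CyclicPair x y :=
  ⟨x * y, mem_zpowers_mul_of_coprime hc h, hc.eq ▸ mem_zpowers_mul_of_coprime hc.symm h.symm⟩

theorem cyclicPair_prod_iff (h : (Nat.card G).Coprime (Nat.card H)) {x y : G × H} :
    CyclicPair x y ↔ CyclicPair x.1 y.1 ∧ CyclicPair x.2 y.2 := by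
  refine ⟨fun hxy => ⟨hxy.map (MonoidHom.fst G H), hxy.map (MonoidHom.snd G H)⟩, ?_⟩
  rintro ⟨⟨w, hx1, hy1⟩, ⟨z, hx2, hy2⟩⟩
  have hco : (orderOf ((w, 1) : G × H)).Coprime (orderOf ((1, z) : G × H)) := by
    simp only [Prod.orderOf_mk, orderOf_one, Nat.lcm_one_left, Nat.lcm_one_right]
    exact (h.coprime_dvd_left (orderOf_dvd_natCard w)).coprime_dvd_right (orderOf_dvd_natCard z)
  have hcm : Commute ((w, 1) : G × H) (1, z) := by simp [Commute, SemiconjBy]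
  have h1 := mem_zpowers_mul_of_coprime hcm hco
  have h2 := mem_zpowers_mul_of_coprime hcm.symm hco.symm
  rw [← hcm.eq] at h2
  have key : ∀ t : G × H, t.1 ∈ Subgroup.zpowers w → t.2 ∈ Subgroup.zpowers z →
      t ∈ Subgroup.zpowers (((w, 1) : G × H) * (1, z)) := by
    rintro ⟨_, _⟩ ⟨i, rfl⟩ ⟨j, rfl⟩
    convert mul_mem (zpow_mem h1 i) (zpow_mem h2 j) using 1
    simp
  exact ⟨_, key x hx1 hx2, key y hy1 hy2⟩

/-- Elements of order `p` in a common cyclic subgroup generate the same subgroup. -/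
theorem CyclicPair.zpowers_eq [Finite G] {p : ℕ} (hp : p.Prime) {x y : G} (h : CyclicPair x y)
    (hx : orderOf x = p) (hy : orderOf y = p) : Subgroup.zpowers x = Subgroup.zpowers y := by
  classical
  obtain ⟨w, hxw, hyw⟩ := h
  have := Fintype.ofFinite (Subgroup.zpowers w)
  let x' : Subgroup.zpowers w := ⟨x, hxw⟩
  let y' : Subgroup.zpowers w := ⟨y, hyw⟩
  have hx' : orderOf x' = p := by rw [← hx]; exact Subgroup.orderOf_mk x hxw
  have hy' : orderOf y' = p := by rw [← hy]; exact Subgroup.orderOf_mk y hyw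
  -- A cyclic group has at most `p` solutions of `g ^ p = 1`, and `⟨x'⟩` already supplies `p` of
  -- them.
  have hsub : (Finset.univ.filter fun g => g ∈ Subgroup.zpowers x') ⊆
      Finset.univ.filter fun g : Subgroup.zpowers w => g ^ p = 1 := by
    intro g hg
    obtain ⟨i, rfl⟩ := (Finset.mem_filter.mp hg).2
    refine Finset.mem_filter.mpr ⟨Finset.mem_univ _, ?_⟩
    change (x' ^ i) ^ p = 1
    rw [← zpow_natCast, zpow_comm, zpow_natCast, ← hx', pow_orderOf_eq_one, one_zpow]
  have hcard : (Finset.univ.filter fun g => g ∈ Subgroup.zpowers x').card = p := by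
    rw [← hx', ← Nat.card_zpowers, ← Fintype.card_subtype, Nat.card_eq_fintype_card]
  have heq := Finset.eq_of_subset_of_card_le hsub
    ((IsCyclic.card_pow_eq_one_le hp.pos).trans hcard.ge)
  have hmem : y' ∈ Finset.univ.filter fun g : Subgroup.zpowers w => g ^ p = 1 :=
    Finset.mem_filter.mpr ⟨Finset.mem_univ _, hy' ▸ pow_orderOf_eq_one y'⟩
  rw [← heq] at hmem
  obtain ⟨i, hi⟩ := (Finset.mem_filter.mp hmem).2
  have hyx : y ∈ Subgroup.zpowers x := ⟨i, by simpa using congrArg Subtype.val hi⟩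
  exact (Subgroup.eq_of_le_of_card_ge (Subgroup.zpowers_le.mpr hyx)
    (by rw [Nat.card_zpowers, Nat.card_zpowers, hx, hy])).symm

end CyclicPair

/-! ### The strong domination number in terms of cyclic pairs -/

/-- `D` consists of non-dominating vertices of the enhanced power graph, and each non-dominating
vertex has a neighbour in `D`. -/
structure TotallyDominates {G : Type*} [Group G] (D : Finset G) : Prop where
  nondominating : ∀ d ∈ D, ∃ y, ¬ CyclicPair d y
  exists_adj : ∀ x : G, (∃ y, ¬ CyclicPair x y) → ∃ d ∈ D, x ≠ d ∧ CyclicPair x d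

theorem not_isDominatingVertex_iff {G : Type u} [Group G] (x : G) :
    ¬ IsDominatingVertex (enhancedPowerGraph G) x ↔ ∃ y, ¬ CyclicPair x y := by
  constructor
  · intro h
    by_contra! h'
    exact h fun y hy => ⟨hy.symm, h' y⟩
  · rintro ⟨y, hy⟩ h
    refine hy (h y ?_).2
    rintro rfl
    exact hy (cyclicPair_self y)

theorem strongDominationNumber_eq_sInf (G : Type u) [Group G] :
    strongDominationNumber (properEnhancedPowerGraph G) =
      sInf {t : ℕ | ∃ D : Finset G, TotallyDominates D ∧ D.card = t} := by
  classical
  unfold strongDominationNumber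
  congr 1
  ext t
  constructor
  · rintro ⟨D, hD, rfl⟩
    refine ⟨D.map (Function.Embedding.subtype _), ⟨?_, ?_⟩, by simp⟩
    · intro d hd
      obtain ⟨d', -, rfl⟩ := Finset.mem_map.mp hd
      exact (not_isDominatingVertex_iff _).mp d'.2
    · intro x hx
      obtain ⟨y, hy, hxy⟩ := hD ⟨x, (not_isDominatingVertex_iff x).mpr hx⟩
      have hxy' : (enhancedPowerGraph G).Adj x y := hxy
      exact ⟨y, Finset.mem_map.mpr ⟨y, hy, rfl⟩, hxy'.1, hxy'.2⟩
  · rintro ⟨D, hD, rfl⟩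
    refine ⟨D.attach.map ⟨fun d => ⟨d.1, (not_isDominatingVertex_iff _).mpr
      (hD.nondominating d.1 d.2)⟩, fun a b h => Subtype.ext (by simpa using h)⟩, ?_, by simp⟩
    intro x
    obtain ⟨d, hd, hne, hxd⟩ := hD.exists_adj x.1 ((not_isDominatingVertex_iff _).mp x.2)
    refine ⟨⟨d, (not_isDominatingVertex_iff _).mpr (hD.nondominating d hd)⟩, ?_, ?_⟩
    · simp only [Finset.coe_map, Set.mem_image]
      exact ⟨⟨d, hd⟩, by simp, rfl⟩
    · exact (⟨hne, hxd⟩ : (enhancedPowerGraph G).Adj x.1 d)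

theorem TotallyDominates.map {G H : Type*} [Group G] [Group H] (e : G ≃* H) {D : Finset G}
    (hD : TotallyDominates D) : TotallyDominates (D.map e.toEquiv.toEmbedding) := by
  constructor
  · intro d hd
    obtain ⟨d, hd', rfl⟩ := Finset.mem_map.mp hd
    obtain ⟨y, hy⟩ := hD.nondominating d hd'
    exact ⟨e y, fun h => hy ((cyclicPair_map_iff e).mp h)⟩
  · rintro x ⟨y, hy⟩
    obtain ⟨d, hd, hne, hxd⟩ := hD.exists_adj (e.symm x)
      ⟨e.symm y, fun h => hy ((cyclicPair_map_iff e.symm).mp h)⟩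
    refine ⟨e d, Finset.mem_map.mpr ⟨d, hd, rfl⟩, ?_, ?_⟩
    · rintro rfl
      simp at hne
    · simpa using (cyclicPair_map_iff e).mpr hxd

theorem strongDominationNumber_congr {G : Type u} {H : Type v} [Group G] [Group H] (e : G ≃* H) :
    strongDominationNumber (properEnhancedPowerGraph G) =
      strongDominationNumber (properEnhancedPowerGraph H) := by
  rw [strongDominationNumber_eq_sInf, strongDominationNumber_eq_sInf]
  congr 1
  ext t
  exact ⟨fun ⟨D, hD, h⟩ => ⟨_, hD.map e, by simpa using h⟩,
    fun ⟨D, hD, h⟩ => ⟨_, hD.map e.symm, by simpa using h⟩⟩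

/-- The first hypothesis also excludes the default value `0` of the infimum of the empty set. -/
theorem strongDominationNumber_eq_of {G : Type u} [Group G] {N : ℕ}
    (hle : ∃ D : Finset G, TotallyDominates D ∧ D.card ≤ N)
    (hge : ∀ D : Finset G, TotallyDominates D → N ≤ D.card) :
    strongDominationNumber (properEnhancedPowerGraph G) = N := by
  rw [strongDominationNumber_eq_sInf]
  obtain ⟨D, hD, hDN⟩ := hle
  apply le_antisymm
  · exact le_trans (Nat.sInf_le ⟨D, hD, rfl⟩) hDN
  · refine le_csInf ⟨D.card, D, hD, rfl⟩ ?_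
    rintro _ ⟨D', hD', rfl⟩
    exact hge D' hD'

/-! ### Quaternion groups -/

section Quaternion

open QuaternionGroup

variable {m : ℕ}

/-- The maximal cyclic subgroup containing a noncentral element: `none` for `⟨a 1⟩`, and
`some i` for `⟨xa i⟩`. -/
def maxCyclicIndex : QuaternionGroup m → Option (ZMod m)
  | a _ => none
  | xa i => some (ZMod.castHom (Dvd.intro_left 2 rfl : m ∣ 2 * m) (ZMod m) i)

/-- The kernel of reduction is `{0, m}`, which matches the two noncentral elements `xa i` and `xa (i
+ m)` of `⟨xa i⟩`. -/
theorem castHom_eq_iff [NeZero m] (i j : ZMod (2 * m)) :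
    ZMod.castHom (Dvd.intro_left 2 rfl : m ∣ 2 * m) (ZMod m) i =
      ZMod.castHom (Dvd.intro_left 2 rfl : m ∣ 2 * m) (ZMod m) j ↔ i = j ∨ i = j + m := by
  have hm : 0 < m := Nat.pos_of_neZero m
  have : NeZero (2 * m) := ⟨by omega⟩
  constructor
  · intro h
    have h0 : ZMod.castHom (Dvd.intro_left 2 rfl : m ∣ 2 * m) (ZMod m) (i - j) = 0 := by
      rw [map_sub, h, sub_self]
    rw [← ZMod.natCast_zmod_val (i - j), map_natCast, ZMod.natCast_eq_zero_iff] at h0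
    obtain ⟨t, ht⟩ := h0
    have hlt := ZMod.val_lt (i - j)
    have ht2 : t < 2 := by
      rw [ht, mul_comm 2 m] at hlt
      exact Nat.lt_of_mul_lt_mul_left hlt
    have hij : i = j + ((i - j).val : ZMod (2 * m)) := by
      rw [ZMod.natCast_zmod_val]; ring
    rw [ht] at hij
    interval_cases t
    · left; simpa using hij
    · right; simpa using hij
  · rintro (rfl | rfl)
    · rfl
    · simp

theorem natCast_ne_zero_of_pos_of_lt {i : ℕ} (h0 : 0 < i) (h : i < 2 * m) :
    (i : ZMod (2 * m)) ≠ 0 := by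
  rw [Ne, ZMod.natCast_eq_zero_iff]
  exact Nat.not_dvd_of_pos_of_lt h0 h

theorem natCast_add_self_eq_zero : (m : ZMod (2 * m)) + m = 0 := by
  have := ZMod.natCast_self (2 * m)
  push_cast at this
  rw [← this]; ring

theorem mem_zpowers_a {i : ZMod (2 * m)} {q : QuaternionGroup m}
    (h : q ∈ Subgroup.zpowers (a i)) : ∃ j, q = a j := by
  have : Subgroup.zpowers (a i) ≤
      { carrier := {q : QuaternionGroup m | ∃ j, q = a j}
        one_mem' := ⟨0, one_def⟩
        mul_mem' := by
          rintro _ _ ⟨j, rfl⟩ ⟨l, rfl⟩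
          exact ⟨j + l, a_mul_a j l⟩
        inv_mem' := by
          rintro _ ⟨j, rfl⟩
          exact ⟨-j, rfl⟩ } := by
    rw [Subgroup.zpowers_le]
    exact ⟨i, rfl⟩
  exact this h

/-- Since `xa i` squares to `a m`, these four elements are closed under products and inverses. -/
theorem mem_zpowers_xa {i : ZMod (2 * m)} {q : QuaternionGroup m} :
    q ∈ Subgroup.zpowers (xa i) ↔ q = 1 ∨ q = a m ∨ q = xa i ∨ q = xa (i + (m : ZMod (2 * m))) := by
  have h0 := natCast_add_self_eq_zero (m := m)
  have hneg : -(m : ZMod (2 * m)) = m := neg_eq_of_add_eq_zero_left h0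
  constructor
  · intro h
    have : Subgroup.zpowers (xa i) ≤
        { carrier := {q : QuaternionGroup m | q = 1 ∨ q = a m ∨ q = xa i ∨ q = xa (i + (m : ZMod (2 * m)))}
          one_mem' := Or.inl rfl
          mul_mem' := by
            have e1 : i - (m : ZMod (2 * m)) = i + m := by rw [sub_eq_add_neg, hneg]
            have e2 : i + (m : ZMod (2 * m)) + m = i := by rw [add_assoc, h0, add_zero]
            have e3 : (m : ZMod (2 * m)) + (i + m) - i = 0 := by rw [← h0]; ring
            have e4 : (m : ZMod (2 * m)) + i - (i + m) = 0 := by ring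
            have e5 : (m : ZMod (2 * m)) + i - i = m := by ring
            have e6 : (m : ZMod (2 * m)) + (i + m) - (i + m) = m := by ring
            have e7 : i + (m : ZMod (2 * m)) - m = i := by ring
            rintro _ _ (rfl | rfl | rfl | rfl) (rfl | rfl | rfl | rfl) <;>
              simp only [one_mul, mul_one, Set.mem_ofPred_eq, a_mul_a, a_mul_xa, xa_mul_a,
                xa_mul_xa, h0, e1, e2, e3, e4, e5, e6, e7, a_zero, true_or, or_true]
          inv_mem' := by
            rintro _ (rfl | rfl | rfl | rfl)
            · exact Or.inl inv_one
            · exact Or.inr (Or.inl (congrArg a hneg))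
            · refine Or.inr (Or.inr (Or.inr ?_))
              rw [inv_eq_iff_mul_eq_one, xa_mul_xa, ← a_zero]
              congr 1; rw [← h0]; ring
            · refine Or.inr (Or.inr (Or.inl ?_))
              rw [inv_eq_iff_mul_eq_one, xa_mul_xa, ← a_zero]
              congr 1; ring } := by
      rw [Subgroup.zpowers_le]
      exact Or.inr (Or.inr (Or.inl rfl))
    exact this h
  · have hx := Subgroup.mem_zpowers (xa i : QuaternionGroup m)
    have ham : a m ∈ Subgroup.zpowers (xa i : QuaternionGroup m) := by
      rw [← xa_sq i]; exact pow_mem hx 2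
    rintro (rfl | rfl | rfl | rfl)
    · exact one_mem _
    · exact ham
    · exact hx
    · rw [← xa_mul_a]; exact mul_mem hx ham

theorem mem_zpowers_a_one [NeZero m] (i : ZMod (2 * m)) :
    a i ∈ Subgroup.zpowers (a 1 : QuaternionGroup m) := by
  have hm : 0 < m := Nat.pos_of_neZero m
  have : NeZero (2 * m) := ⟨by omega⟩
  rw [← ZMod.natCast_zmod_val i, ← a_one_pow]
  exact pow_mem (Subgroup.mem_zpowers _) _

/-- The two central elements of a generalized quaternion group. -/
def IsQuatCentral (q : QuaternionGroup m) : Prop := q = 1 ∨ q = a m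

theorem IsQuatCentral.cyclicPair [NeZero m] {q : QuaternionGroup m} (hq : IsQuatCentral q)
    (q' : QuaternionGroup m) : CyclicPair q q' := by
  rcases hq with rfl | rfl
  · exact cyclicPair_one_left q'
  · rcases q' with i | i
    · exact ⟨_, mem_zpowers_a_one _, mem_zpowers_a_one _⟩
    · exact ⟨xa i, mem_zpowers_xa.mpr (by simp), Subgroup.mem_zpowers _⟩

/-- Every cyclic subgroup lies in `⟨a 1⟩` or is some `⟨xa i⟩`, and distinct ones among these meet in
`{1, a m}`. -/
theorem cyclicPair_quaternion_iff [NeZero m] {q q' : QuaternionGroup m} (hq : ¬ IsQuatCentral q)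
    (hq' : ¬ IsQuatCentral q') :
    CyclicPair q q' ↔ maxCyclicIndex q = maxCyclicIndex q' := by
  have aux : ∀ {i j : ZMod (2 * m)}, ¬ IsQuatCentral (a i) → ¬ CyclicPair (a i) (xa j) := by
    rintro i j hi ⟨w, h1, h2⟩
    rcases w with w | w
    · obtain ⟨l, hl⟩ := mem_zpowers_a h2
      cases hl
    · rcases mem_zpowers_xa.mp h1 with h | h | h | h
      · exact hi (Or.inl h)
      · exact hi (Or.inr h)
      · cases h
      · cases h
  have h0 := natCast_add_self_eq_zero (m := m)
  rcases q with i | i <;> rcases q' with j | j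
  · simp only [maxCyclicIndex, iff_true]
    exact ⟨_, mem_zpowers_a_one _, mem_zpowers_a_one _⟩
  · simp [maxCyclicIndex, aux hq]
  · simp only [maxCyclicIndex, reduceCtorEq, iff_false]
    exact fun h => aux hq' h.symm
  · simp only [maxCyclicIndex, Option.some.injEq, castHom_eq_iff]
    constructor
    · rintro ⟨w, h1, h2⟩
      rcases w with w | w
      · obtain ⟨l, hl⟩ := mem_zpowers_a h1
        cases hl
      · rw [mem_zpowers_xa, one_def] at h1 h2
        simp only [reduceCtorEq, xa.injEq, false_or] at h1 h2
        rcases h1 with rfl | rfl <;> rcases h2 with rfl | rfl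
        · simp
        · right; rw [add_assoc, h0, add_zero]
        · simp
        · simp
    · rintro (rfl | rfl)
      · exact cyclicPair_self _
      · exact (cyclicPair_of_mem_zpowers (mem_zpowers_xa.mpr (by simp))).symm

/-- Two elements per class are needed because a vertex is not its own neighbour. The bound on `m`
keeps `a 1` distinct from `1`, `a m` and its inverse. -/
theorem exists_noncentral_pair (hm : 2 ≤ m) (c : Option (ZMod m)) :
    ∃ q q' : QuaternionGroup m, q ≠ q' ∧ ¬ IsQuatCentral q ∧ ¬ IsQuatCentral q' ∧
      maxCyclicIndex q = c ∧ maxCyclicIndex q' = c := by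
  have : NeZero m := ⟨by omega⟩
  rcases c with _ | c
  · have h1 : ¬ IsQuatCentral (a 1 : QuaternionGroup m) := by
      rintro (h | h)
      · rw [one_def, a.injEq] at h
        exact natCast_ne_zero_of_pos_of_lt (m := m) (i := 1) (by omega) (by omega) (by simpa using h)
      · rw [a.injEq] at h
        refine natCast_ne_zero_of_pos_of_lt (m := m) (i := m - 1) (by omega) (by omega) ?_
        rw [Nat.cast_sub (by omega), ← h]; simp
    refine ⟨a 1, (a 1)⁻¹, ?_, h1, ?_, rfl, rfl⟩
    · intro h
      have h2 : (a 1 : QuaternionGroup m) * a 1 = 1 := by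
        nth_rewrite 2 [h]; simp
      rw [a_mul_a, one_def, a.injEq] at h2
      exact natCast_ne_zero_of_pos_of_lt (m := m) (i := 2) (by omega) (by omega)
        (by rw [← h2]; norm_num)
    · rintro (h | h)
      · exact h1 (Or.inl (inv_eq_one.mp h))
      · refine h1 (Or.inr ?_)
        rw [inv_eq_iff_eq_inv] at h
        rw [h, inv_eq_iff_mul_eq_one, a_mul_a, natCast_add_self_eq_zero, a_zero]
  · have hxa : ∀ i : ZMod (2 * m), ¬ IsQuatCentral (xa i) := by
      rintro i (h | h)
      · rw [one_def] at h; cases h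
      · cases h
    refine ⟨xa (c.val : ℕ), xa ((c.val : ℕ) + m), ?_, hxa _, hxa _, ?_, ?_⟩
    · intro h
      rw [xa.injEq] at h
      exact natCast_ne_zero_of_pos_of_lt (m := m) (i := m) (by omega) (by omega)
        (left_eq_add.mp h)
    · simp only [maxCyclicIndex, map_natCast, ZMod.natCast_zmod_val]
    · simp only [maxCyclicIndex, map_add, map_natCast, ZMod.natCast_zmod_val, ZMod.natCast_self,
        add_zero]

end Quaternion

/-! ### Cyclic times quaternion: disjoint cliques. -/

theorem exists_not_cyclicPair_of_not_isQuatCentral {m : ℕ} (hm : 2 ≤ m) {q : QuaternionGroup m}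
    (hq : ¬ IsQuatCentral q) : ∃ q', ¬ CyclicPair q q' := by
  have : NeZero m := ⟨by omega⟩
  obtain ⟨c, hc⟩ := exists_ne (maxCyclicIndex q)
  obtain ⟨q', -, -, hq', -, h, -⟩ := exists_noncentral_pair hm c
  exact ⟨q', fun h' => hc (h ▸ ((cyclicPair_quaternion_iff hq hq').mp h').symm)⟩

/-- A cyclic factor of coprime order does not change the structure of maximal cyclic subgroups of a
quaternion group, so the proper enhanced power graph is a union of `m + 1` disjoint cliques. -/
theorem strongDominationNumber_cyclic_prod_quaternion {C : Type u} [Group C] [IsCyclic C] {m : ℕ}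
    (hm : 2 ≤ m) (hC : (Nat.card C).Coprime (Nat.card (QuaternionGroup m))) :
    strongDominationNumber (properEnhancedPowerGraph (C × QuaternionGroup m)) =
      2 * (m + 1) := by
  classical
  have : NeZero m := ⟨by omega⟩
  have hcp : ∀ x y : C × QuaternionGroup m, CyclicPair x y ↔ CyclicPair x.2 y.2 := fun x y => by
    rw [cyclicPair_prod_iff hC]
    exact and_iff_right (cyclicPair_of_isCyclic _ _)
  have hvert : ∀ x : C × QuaternionGroup m, (∃ y, ¬ CyclicPair x y) ↔ ¬ IsQuatCentral x.2 := by
    intro x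
    constructor
    · rintro ⟨y, hy⟩ h
      exact hy ((hcp x y).mpr (h.cyclicPair y.2))
    · intro h
      obtain ⟨q, hq⟩ := exists_not_cyclicPair_of_not_isQuatCentral hm h
      exact ⟨(1, q), fun h' => hq ((hcp _ _).mp h')⟩
  have hcardO : Fintype.card (Option (ZMod m)) = m + 1 := by
    rw [Fintype.card_option, ZMod.card]
  apply strongDominationNumber_eq_of
  · choose r r' hne hr hr' hc hc' using exists_noncentral_pair hm
    refine ⟨Finset.univ.image (fun c => ((1 : C), r c)) ∪
      Finset.univ.image (fun c => ((1 : C), r' c)), ⟨?_, ?_⟩, ?_⟩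
    · intro d hd
      rw [hvert]
      simp only [Finset.mem_union, Finset.mem_image, Finset.mem_univ, true_and] at hd
      rcases hd with ⟨c, rfl⟩ | ⟨c, rfl⟩
      · exact hr c
      · exact hr' c
    · intro x hx
      rw [hvert] at hx
      by_cases h : x = (1, r (maxCyclicIndex x.2))
      · refine ⟨(1, r' (maxCyclicIndex x.2)), ?_, ?_, ?_⟩
        · exact Finset.mem_union_right _ (Finset.mem_image_of_mem _ (Finset.mem_univ _))
        · intro h'
          exact hne _ (congrArg Prod.snd (h.symm.trans h'))
        · rw [hcp, cyclicPair_quaternion_iff hx (hr' _), hc']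
      · refine ⟨(1, r (maxCyclicIndex x.2)), ?_, h, ?_⟩
        · exact Finset.mem_union_left _ (Finset.mem_image_of_mem _ (Finset.mem_univ _))
        · rw [hcp, cyclicPair_quaternion_iff hx (hr _), hc]
    · refine (Finset.card_union_le _ _).trans ?_
      have h1 := Finset.card_image_le (s := Finset.univ) (f := fun c => ((1 : C), r c))
      have h2 := Finset.card_image_le (s := Finset.univ) (f := fun c => ((1 : C), r' c))
      rw [Finset.card_univ, hcardO] at h1 h2
      omega
  · intro D hD
    have hfib : ∀ c : Option (ZMod m), 2 ≤ (D.filter fun d => maxCyclicIndex d.2 = c).card := by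
      intro c
      obtain ⟨q, -, -, hq, -, hqc, -⟩ := exists_noncentral_pair hm c
      have step : ∀ x : C × QuaternionGroup m, ¬ IsQuatCentral x.2 → maxCyclicIndex x.2 = c →
          ∃ d ∈ D, x ≠ d ∧ ¬ IsQuatCentral d.2 ∧ maxCyclicIndex d.2 = c := by
        intro x hx hxc
        obtain ⟨d, hd, hne, hxd⟩ := hD.exists_adj x ((hvert x).mpr hx)
        have hd' := (hvert d).mp (hD.nondominating d hd)
        exact ⟨d, hd, hne, hd', hxc ▸ ((cyclicPair_quaternion_iff hx hd').mp ((hcp _ _).mp hxd)).symm⟩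
      -- The neighbour `d` is itself a vertex and needs a second neighbour in its own clique.
      obtain ⟨d, hd, -, hdn, hdc⟩ := step (1, q) hq hqc
      obtain ⟨e, he, hne, -, hec⟩ := step d hdn hdc
      exact Finset.one_lt_card.mpr ⟨d, Finset.mem_filter.mpr ⟨hd, hdc⟩, e,
        Finset.mem_filter.mpr ⟨he, hec⟩, hne⟩
    rw [Finset.card_eq_sum_card_fiberwise (f := fun d => maxCyclicIndex d.2)
      (t := Finset.univ) (fun _ _ => Finset.mem_coe.mpr (Finset.mem_univ _))]
    have := Finset.card_nsmul_le_sum Finset.univ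
      (fun c => (D.filter fun d => maxCyclicIndex d.2 = c).card) 2 fun c _ => hfib c
    rw [Finset.card_univ, hcardO, smul_eq_mul, mul_comm] at this
    exact this

/-! ### Subgroups of prime order -/

section PrimeOrder

variable {G : Type*} [Group G]

/-- The subgroup of order `p` of `⟨g⟩`, for a prime divisor `p` of the order of `g`. -/
noncomputable def primeSubgroup (p : ℕ) (g : G) : Subgroup G := Subgroup.zpowers (g ^ (orderOf g / p))

theorem primeSubgroup_le (p : ℕ) (g : G) : primeSubgroup p g ≤ Subgroup.zpowers g :=
  Subgroup.zpowers_le.mpr (pow_mem (Subgroup.mem_zpowers g) _)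

variable [Finite G]

theorem card_primeSubgroup {p : ℕ} {g : G} (h : p ∣ orderOf g) :
    Nat.card (primeSubgroup p g) = p := by
  rw [primeSubgroup, Nat.card_zpowers, orderOf_pow_orderOf_div (orderOf_pos g).ne' h]

theorem CyclicPair.primeSubgroup_eq {p : ℕ} (hp : p.Prime) {g h : G} (hgh : CyclicPair g h)
    (hg : p ∣ orderOf g) (hh : p ∣ orderOf h) : primeSubgroup p g = primeSubgroup p h := by
  refine CyclicPair.zpowers_eq hp ?_ (orderOf_pow_orderOf_div (orderOf_pos g).ne' hg)
    (orderOf_pow_orderOf_div (orderOf_pos h).ne' hh)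
  obtain ⟨w, h1, h2⟩ := hgh
  exact ⟨w, pow_mem h1 _, pow_mem h2 _⟩

theorem primeSubgroup_eq_of_mem {p : ℕ} (hp : p.Prime) {g z : G} (hz : orderOf z = p)
    (h : z ∈ Subgroup.zpowers g) : primeSubgroup p g = Subgroup.zpowers z := by
  have hpg : p ∣ orderOf g := hz ▸ orderOf_dvd_of_mem_zpowers h
  rw [CyclicPair.primeSubgroup_eq hp (cyclicPair_of_mem_zpowers h) hpg (by rw [hz]),
    primeSubgroup, hz, Nat.div_self hp.pos, pow_one]

theorem exists_zpowers_eq_of_card_prime {p : ℕ} (hp : p.Prime) {H : Subgroup G}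
    (hH : Nat.card H = p) : ∃ z : G, orderOf z = p ∧ Subgroup.zpowers z = H := by
  have := Fact.mk hp
  obtain ⟨z, hz⟩ := exists_prime_orderOf_dvd_card' (G := H) p hH.symm.dvd
  have hz' : orderOf (z : G) = p := by rw [← hz, Subgroup.orderOf_coe]
  exact ⟨z, hz', Subgroup.eq_of_le_of_card_ge (Subgroup.zpowers_le.mpr z.2)
    (by rw [Nat.card_zpowers, hz', hH])⟩

/-- The Sylow subgroup is normal, hence unique, and so contains every subgroup of order `p`. -/
theorem numSubgroups_sylow {G : Type u} [Group G] [Finite G] [Group.IsNilpotent G] {p : ℕ}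
    (hp : p.Prime) (P : Sylow p G) : numSubgroups P p = numSubgroups G p := by
  have := Fact.mk hp
  have hn : (P : Subgroup G).Normal := inferInstance
  have := Sylow.unique_of_normal P hn
  have hcard : ∀ H : Subgroup P, Nat.card (H.map (P : Subgroup G).subtype) = Nat.card H := fun H =>
    Nat.card_congr (H.equivMapOfInjective _ (P : Subgroup G).subtype_injective).symm.toEquiv
  refine Nat.card_congr (Equiv.ofBijective
    (fun H => ⟨H.1.map (P : Subgroup G).subtype, (hcard H.1).trans H.2⟩) ⟨?_, ?_⟩)
  · intro H K h
    exact Subtype.ext (Subgroup.map_injective (P : Subgroup G).subtype_injective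
      (congrArg Subtype.val h))
  · rintro ⟨K, hK⟩
    obtain ⟨Q, hQ⟩ := (IsPGroup.of_card (n := 1) (by rw [hK, pow_one]) :
      IsPGroup p K).exists_le_sylow
    obtain rfl := Subsingleton.elim Q P
    have hmap : (K.subgroupOf Q).map (Q : Subgroup G).subtype = K :=
      Subgroup.map_subgroupOf_eq_of_le hQ
    exact ⟨⟨K.subgroupOf Q, by rw [← hcard, hmap, hK]⟩, Subtype.ext hmap⟩

/-- If a Sylow `p`-subgroup is not cyclic, `p` odd, then no element of order `p` is in a cyclic
pair with all elements of order `p`. -/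
theorem exists_not_cyclicPair_of_sylow_not_isCyclic {p : ℕ} (hp : p.Prime) (hp2 : p ≠ 2)
    (P : Sylow p G) (hP : ¬ IsCyclic P) {z : G} (hz : orderOf z = p) :
    ∃ y : G, ¬ CyclicPair z y := by
  have := Fact.mk hp
  -- Otherwise `⟨z⟩` would be the only subgroup of order `p`, forcing `P` to be cyclic.
  by_contra! hall
  obtain ⟨n, hn⟩ := IsPGroup.iff_card.mp P.isPGroup'
  refine hP (isCyclic_of_unique_prime_order hp hp2 n P hn fun x y hx hy hx1 => ?_)
  have hord : ∀ t : P, t ^ p = 1 → t ≠ 1 → orderOf (t : G) = p := fun t ht ht1 => by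
    rw [Subgroup.orderOf_coe]
    exact orderOf_eq_prime ht ht1
  by_cases hy1 : y = 1
  · rw [hy1]; exact one_mem _
  have h1 := (hall x).zpowers_eq hp hz (hord x hx hx1)
  have h2 := (hall y).zpowers_eq hp hz (hord y hy hy1)
  obtain ⟨i, hi⟩ : (y : G) ∈ Subgroup.zpowers (x : G) := by
    rw [← h1, h2]; exact Subgroup.mem_zpowers _
  exact ⟨i, Subtype.ext (by simpa using hi)⟩

theorem exists_mem_zpowers_of_primes [Group.IsNilpotent G] (s : Finset ℕ) (z : ℕ → G)
    (hz : ∀ p ∈ s, p.Prime ∧ orderOf (z p) = p) :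
    ∃ h : G, orderOf h = ∏ p ∈ s, p ∧ ∀ p ∈ s, z p ∈ Subgroup.zpowers h := by
  induction s using Finset.induction_on with
  | empty => exact ⟨1, by simp⟩
  | insert q s hq ih =>
    obtain ⟨h, hord, hmem⟩ := ih fun p hp => hz p (Finset.mem_insert_of_mem hp)
    obtain ⟨hqp, hzq⟩ := hz q (Finset.mem_insert_self q s)
    have hco : (orderOf (z q)).Coprime (orderOf h) := by
      rw [hzq, hord]
      refine Nat.Coprime.prod_right fun p hp => ?_
      refine (Nat.coprime_primes hqp (hz p (Finset.mem_insert_of_mem hp)).1).mpr ?_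
      rintro rfl
      exact hq hp
    have hcm := commute_of_coprime_orderOf hco
    have h1 := mem_zpowers_mul_of_coprime hcm hco
    have h2 := mem_zpowers_mul_of_coprime hcm.symm hco.symm
    rw [← hcm.eq] at h2
    refine ⟨z q * h, ?_, ?_⟩
    · rw [hcm.orderOf_mul_eq_mul_orderOf_of_coprime hco, Finset.prod_insert hq, hzq, hord]
    · intro p hp
      rcases Finset.mem_insert.mp hp with rfl | hp
      · exact h1
      · exact Subgroup.zpowers_le.mpr h2 (hmem p hp)

end PrimeOrder

/-! ### Products with a noncyclic odd part. -/

/-- Used in contrapositive form: two adjacent vertices of `D` take the same value under `f`, so a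
small `D` must miss some value in `T`. -/
theorem injOn_of_surj_of_card_le {α β : Type*} [DecidableEq β] {D : Finset α} {T : Finset β}
    (P : α → Prop) (f : α → β) (hcard : D.card ≤ T.card)
    (hsurj : ∀ b ∈ T, ∃ d ∈ D, P d ∧ f d = b) : (∀ d ∈ D, P d) ∧ Set.InjOn f D := by
  classical
  have hsub : T ⊆ (D.filter P).image f := by
    intro b hb
    obtain ⟨d, hd, hP, rfl⟩ := hsurj b hb
    exact Finset.mem_image_of_mem f (Finset.mem_filter.mpr ⟨hd, hP⟩)
  have h1 := Finset.card_le_card hsub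
  have h2 : ((D.filter P).image f).card ≤ (D.filter P).card := Finset.card_image_le
  have h3 : (D.filter P).card ≤ D.card := Finset.card_filter_le _ _
  have h4 : D.filter P = D := Finset.eq_of_subset_of_card_le (Finset.filter_subset _ _) (by omega)
  refine ⟨Finset.filter_eq_self.mp h4, ?_⟩
  rw [h4] at h2 h1
  exact Finset.card_image_iff.mp (by omega)

theorem strongDominationNumber_noncyclic_prod {G₁ : Type u} {C : Type v} [Group G₁] [Group C]
    [IsCyclic C] {m : ℕ} (hm : 2 ≤ m) (hG : IsNoncyclicPart G₁) (hodd : (Nat.card G₁).Coprime 2)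
    (h1 : (Nat.card G₁).Coprime (Nat.card (C × QuaternionGroup m)))
    (h2 : (Nat.card C).Coprime (Nat.card (QuaternionGroup m))) :
    strongDominationNumber (properEnhancedPowerGraph (G₁ × C × QuaternionGroup m)) =
      min (minNumPrimeSubgroups G₁) (m + 1) + 1 := by
  classical
  have : NeZero m := ⟨by omega⟩
  have := hG.finite
  have := hG.nontrivial
  have := hG.nilpotent
  have := Fintype.ofFinite (Subgroup G₁)
  have hnum : ∀ p, numSubgroups G₁ p =
      (Finset.univ.filter fun H : Subgroup G₁ => Nat.card H = p).card := fun p => by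
    rw [numSubgroups, Nat.card_eq_fintype_card, Fintype.card_subtype]
  have hmin_le : ∀ p : ℕ, p.Prime → p ∣ Nat.card G₁ →
      minNumPrimeSubgroups G₁ ≤ numSubgroups G₁ p := fun p hp hd =>
    Nat.sInf_le ⟨p, hp, hd, default, (numSubgroups_sylow hp default).symm⟩
  obtain ⟨p, hp, hpd, hpmin⟩ : ∃ p : ℕ, p.Prime ∧ p ∣ Nat.card G₁ ∧
      minNumPrimeSubgroups G₁ = numSubgroups G₁ p := by
    have hne : {r : ℕ | ∃ p : ℕ, p.Prime ∧ p ∣ Nat.card G₁ ∧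
        ∃ P : Sylow p G₁, r = numSubgroups P p}.Nonempty := by
      obtain ⟨p, hp, hd⟩ := Nat.exists_prime_and_dvd (Finite.one_lt_card (α := G₁)).ne'
      exact ⟨_, p, hp, hd, default, rfl⟩
    obtain ⟨p, hp, hd, P, hP⟩ := Nat.sInf_mem hne
    exact ⟨p, hp, hd, hP.trans (numSubgroups_sylow hp P)⟩
  have := Fact.mk hp
  have hcp : ∀ x y : G₁ × C × QuaternionGroup m,
      CyclicPair x y ↔ CyclicPair x.1 y.1 ∧ CyclicPair x.2.2 y.2.2 := fun x y => by
    rw [cyclicPair_prod_iff h1, cyclicPair_prod_iff h2]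
    exact and_congr_right fun _ => and_iff_right (cyclicPair_of_isCyclic _ _)
  have hvq : ∀ x : G₁ × C × QuaternionGroup m, ¬ IsQuatCentral x.2.2 → ∃ y, ¬ CyclicPair x y := by
    intro x hx
    obtain ⟨q, hq⟩ := exists_not_cyclicPair_of_not_isQuatCentral hm hx
    exact ⟨(1, 1, q), fun h => hq ((hcp _ _).mp h).2⟩
  have hvz : ∀ z : G₁, orderOf z = p →
      ∃ y, ¬ CyclicPair ((z, 1, 1) : G₁ × C × QuaternionGroup m) y := by
    intro z hz
    have hp2 : p ≠ 2 := by
      rintro rfl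
      exact absurd (Nat.dvd_gcd hpd dvd_rfl) (by rw [hodd]; norm_num)
    obtain ⟨y, hy⟩ := exists_not_cyclicPair_of_sylow_not_isCyclic hp hp2 default
      (hG.sylow p hp hpd default).1 hz
    exact ⟨(y, 1, 1), fun h => hy ((hcp _ _).mp h).1⟩
  have hv : ∀ x : G₁ × C × QuaternionGroup m, (∃ y, ¬ CyclicPair x y) → IsQuatCentral x.2.2 →
      x.1 ≠ 1 := by
    rintro x ⟨y, hy⟩ hq hx
    exact hy ((hcp _ _).mpr ⟨hx ▸ cyclicPair_one_left _, hq.cyclicPair _⟩)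
  have hcardO : (Finset.univ : Finset (Option (ZMod m))).card = m + 1 := by
    rw [Finset.card_univ, Fintype.card_option, ZMod.card]
  choose r _ _ hr _ hrc _ using exists_noncentral_pair hm
  have hone : ∀ {z : G₁}, orderOf z = p → z ≠ 1 := by
    rintro z hz rfl
    rw [orderOf_one] at hz
    exact hp.one_lt.ne hz
  apply strongDominationNumber_eq_of
  · rcases le_total (minNumPrimeSubgroups G₁) (m + 1) with hle | hle
    · rw [min_eq_left hle, hpmin]
      have hgen : ∀ H : {H : Subgroup G₁ // Nat.card H = p},
          ∃ z : G₁, orderOf z = p ∧ Subgroup.zpowers z = H.1 := fun H =>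
        exists_zpowers_eq_of_card_prime hp H.2
      choose z hz hzH using hgen
      -- The inserted vertex serves only as a neighbour of the vertices `(z H, 1, 1)`.
      refine ⟨insert (1, 1, r none) (Finset.univ.image fun H => (z H, 1, 1)), ⟨?_, ?_⟩, ?_⟩
      · intro d hd
        rcases Finset.mem_insert.mp hd with rfl | hd
        · exact hvq _ (hr none)
        · obtain ⟨H, -, rfl⟩ := Finset.mem_image.mp hd
          exact hvz _ (hz H)
      · intro x _
        obtain ⟨H, hH⟩ : ∃ H, CyclicPair x.1 (z H) := by
          by_cases hpx : p ∣ orderOf x.1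
          · refine ⟨⟨primeSubgroup p x.1, card_primeSubgroup hpx⟩, cyclicPair_of_mem_zpowers ?_⟩
            exact primeSubgroup_le p x.1 ((hzH ⟨_, card_primeSubgroup hpx⟩).le
              (Subgroup.mem_zpowers _))
          -- If `p` does not divide the order of `x.1`, any subgroup of order `p` will do, by
          -- coprimality.
          · obtain ⟨g, hg⟩ := exists_prime_orderOf_dvd_card' p hpd
            let H : {H : Subgroup G₁ // Nat.card H = p} :=
              ⟨Subgroup.zpowers g, by rw [Nat.card_zpowers, hg]⟩
            have hco : (orderOf x.1).Coprime (orderOf (z H)) := by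
              rw [hz H]
              exact ((Nat.Prime.coprime_iff_not_dvd hp).mpr hpx).symm
            exact ⟨H, cyclicPair_of_coprime (commute_of_coprime_orderOf hco) hco⟩
        by_cases hx : x = (z H, 1, 1)
        · subst hx
          refine ⟨(1, 1, r none), Finset.mem_insert_self _ _, ?_, ?_⟩
          · intro h
            exact hone (hz H) (congrArg Prod.fst h)
          · exact (hcp _ _).mpr ⟨cyclicPair_one_right _, cyclicPair_one_left _⟩
        · exact ⟨(z H, 1, 1), Finset.mem_insert_of_mem
            (Finset.mem_image_of_mem _ (Finset.mem_univ _)), hx,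
            (hcp _ _).mpr ⟨hH, cyclicPair_one_right _⟩⟩
      · refine (Finset.card_insert_le _ _).trans (Nat.succ_le_succ (Finset.card_image_le.trans ?_))
        rw [numSubgroups, Nat.card_eq_fintype_card, Finset.card_univ]
    · rw [min_eq_right hle]
      obtain ⟨z, hz⟩ := exists_prime_orderOf_dvd_card' p hpd
      refine ⟨insert (z, 1, 1) (Finset.univ.image fun c => (1, 1, r c)), ⟨?_, ?_⟩, ?_⟩
      · intro d hd
        rcases Finset.mem_insert.mp hd with rfl | hd
        · exact hvz _ hz
        · obtain ⟨c, -, rfl⟩ := Finset.mem_image.mp hd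
          exact hvq _ (hr c)
      · intro x _
        obtain ⟨c, hc⟩ : ∃ c, CyclicPair x.2.2 (r c) := by
          by_cases hx : IsQuatCentral x.2.2
          · exact ⟨none, hx.cyclicPair _⟩
          · exact ⟨maxCyclicIndex x.2.2, (cyclicPair_quaternion_iff hx (hr _)).mpr (hrc _).symm⟩
        by_cases hx : x = (1, 1, r c)
        · subst hx
          refine ⟨(z, 1, 1), Finset.mem_insert_self _ _, ?_, ?_⟩
          · intro h
            exact hone hz (congrArg Prod.fst h).symm
          · exact (hcp _ _).mpr ⟨cyclicPair_one_left _, cyclicPair_one_right _⟩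
        · exact ⟨(1, 1, r c), Finset.mem_insert_of_mem
            (Finset.mem_image_of_mem _ (Finset.mem_univ _)), hx,
            (hcp _ _).mpr ⟨cyclicPair_one_right _, hc⟩⟩
      · refine (Finset.card_insert_le _ _).trans (Nat.succ_le_succ (Finset.card_image_le.trans ?_))
        rw [hcardO]
  · intro D hD
    by_contra! hlt
    have hDr : D.card ≤ minNumPrimeSubgroups G₁ :=
      (Nat.lt_succ_iff.mp hlt).trans (min_le_left _ _)
    have hDm : D.card ≤ m + 1 := (Nat.lt_succ_iff.mp hlt).trans (min_le_right _ _)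
    obtain ⟨d, hd, -, -⟩ := hD.exists_adj (1, 1, r none) (hvq _ (hr none))
    -- These adjacent vertices of `D` rule out injectivity in both counts below.
    obtain ⟨d', hd', hne, hdd'⟩ := hD.exists_adj d (hD.nondominating d hd)
    obtain ⟨c, hc⟩ : ∃ c, ∀ e ∈ D, ¬ IsQuatCentral e.2.2 → maxCyclicIndex e.2.2 ≠ c := by
      by_contra! hsurj
      obtain ⟨hP, hinj⟩ := injOn_of_surj_of_card_le (T := Finset.univ)
        (fun e : G₁ × C × QuaternionGroup m => ¬ IsQuatCentral e.2.2)
        (fun e => maxCyclicIndex e.2.2) (hDm.trans hcardO.ge) fun c _ => hsurj c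
      exact hne (hinj hd hd'
        ((cyclicPair_quaternion_iff (hP d hd) (hP d' hd')).mp ((hcp _ _).mp hdd').2))
    have hz : ∀ q : ℕ, q.Prime ∧ q ∣ Nat.card G₁ → ∃ z : G₁, orderOf z = q ∧
        ∀ e ∈ D, q ∣ orderOf e.1 → primeSubgroup q e.1 ≠ Subgroup.zpowers z := by
      rintro q ⟨hq, hqd⟩
      by_contra! hsurj
      obtain ⟨hP, hinj⟩ := injOn_of_surj_of_card_le (D := D)
        (T := Finset.univ.filter fun H : Subgroup G₁ => Nat.card H = q)
        (fun e : G₁ × C × QuaternionGroup m => q ∣ orderOf e.1)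
        (fun e => primeSubgroup q e.1) (hDr.trans ((hmin_le q hq hqd).trans (hnum q).le)) (by
          intro H hH
          obtain ⟨z, hz, rfl⟩ := exists_zpowers_eq_of_card_prime hq (Finset.mem_filter.mp hH).2
          exact hsurj z hz)
      exact hne (hinj hd hd'
        (((hcp _ _).mp hdd').1.primeSubgroup_eq hq (hP d hd) (hP d' hd')))
    choose! z hz hzD using hz
    obtain ⟨h, -, hmem⟩ := exists_mem_zpowers_of_primes (Nat.card G₁).primeFactors z fun q hq =>
      ⟨Nat.prime_of_mem_primeFactors hq,
        hz q ⟨Nat.prime_of_mem_primeFactors hq, Nat.dvd_of_mem_primeFactors hq⟩⟩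
    obtain ⟨e, he, -, hxe⟩ := hD.exists_adj (h, 1, r c) (hvq _ (hr c))
    obtain ⟨hxe1, hxe2⟩ := (hcp _ _).mp hxe
    by_cases heq : IsQuatCentral e.2.2
    -- A vertex with central quaternion part has `e.1 ≠ 1`; at a prime `q` dividing its order,
    -- adjacency to `h` forces the missed subgroup `⟨z q⟩`.
    · have he1 := hv e (hD.nondominating e he) heq
      obtain ⟨q, hq, hqe⟩ := Nat.exists_prime_and_dvd (mt orderOf_eq_one_iff.mp he1)
      have hqd : q ∣ Nat.card G₁ := hqe.trans (orderOf_dvd_natCard _)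
      have hzm := hmem q (Nat.mem_primeFactors.mpr ⟨hq, hqd, Nat.card_pos.ne'⟩)
      have hzo := hz q ⟨hq, hqd⟩
      have hqh : q ∣ orderOf h := by
        have := orderOf_dvd_of_mem_zpowers hzm
        rwa [hzo] at this
      refine hzD q ⟨hq, hqd⟩ e he hqe ?_
      rw [← primeSubgroup_eq_of_mem hq hzo hzm]
      exact (hxe1.primeSubgroup_eq hq hqh hqe).symm
    · exact hc e he heq (((cyclicPair_quaternion_iff (hr c) heq).mp hxe2).symm.trans (hrc c))

/-! ### The main theorem -/

theorem card_genQuaternion {k : ℕ} (hk : 3 ≤ k) : Nat.card (GenQuaternion k) = 2 ^ k := by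
  have : NeZero (2 ^ (k - 2)) := ⟨by positivity⟩
  rw [Nat.card_eq_fintype_card, QuaternionGroup.card, show (4 : ℕ) = 2 ^ 2 by norm_num, ← pow_add]
  congr 1; omega

theorem coprime_card_genQuaternion {k n : ℕ} (hk : 3 ≤ k) (hn : n.Coprime 2) :
    n.Coprime (Nat.card (GenQuaternion k)) := by
  rw [card_genQuaternion hk]
  exact hn.pow_right k

theorem two_le_two_pow_sub_two {k : ℕ} (hk : 3 ≤ k) : 2 ≤ 2 ^ (k - 2) := by
  calc 2 = 2 ^ 1 := by norm_num
    _ ≤ 2 ^ (k - 2) := Nat.pow_le_pow_right (by norm_num) (by omega)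

/-- The prime `2` is split off first, then the odd primes are sorted by whether their Sylow
subgroups are cyclic. -/
theorem exists_decomposition {G : Type u} [Group G] [Finite G] [Group.IsNilpotent G] {k : ℕ}
    (S : Sylow 2 G) (hS : Nonempty (S ≃* GenQuaternion k)) :
    (∃ n : ℕ, Nat.Coprime n 2 ∧
        Nonempty (G ≃* Multiplicative (ZMod n) × GenQuaternion k)) ∨
      (∃ (G₁ : Type u) (_ : Group G₁) (n : ℕ), IsNoncyclicPart G₁ ∧
        Nat.Coprime (Nat.card G₁) n ∧ Nat.Coprime (Nat.card G₁) 2 ∧ Nat.Coprime n 2 ∧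
        Nonempty (G ≃* G₁ × Multiplicative (ZMod n) × GenQuaternion k)) := by
  obtain ⟨σ⟩ := hS
  obtain ⟨A, B, _, _, _, _, hA, hB, ⟨e⟩⟩ := exists_mulEquiv_prod G (fun p => p = 2)
  have h2B : ¬ 2 ∣ Nat.card B := fun h => hB 2 Nat.prime_two h rfl
  -- the factor `A` is its own Sylow `2`-subgroup
  have hAp : IsPGroup 2 A := IsPGroup.of_card
    (Nat.eq_prime_pow_of_unique_prime_dvd Nat.card_pos.ne' fun {q} hq hd => hA q hq hd)
  obtain ⟨P, hP⟩ := (IsPGroup.of_equiv hAp Subgroup.topEquiv.symm :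
    IsPGroup 2 (⊤ : Subgroup A)).exists_le_sylow
  have hPtop : (P : Subgroup A) = ⊤ := top_le_iff.mp hP
  obtain ⟨τ⟩ := nonempty_sylow_mulEquiv e Nat.prime_two h2B P S
  let ε : A ≃* GenQuaternion k := (Subgroup.topEquiv.symm.trans
    (MulEquiv.subgroupCongr hPtop.symm)).trans (τ.trans σ)
  have hBn : Group.IsNilpotent B := Group.nilpotent_of_surjective
    ((MonoidHom.snd A B).comp e.toMonoidHom) (Prod.snd_surjective.comp e.surjective)
  obtain ⟨C, G₁, _, _, _, _, hC, hG₁, ⟨f⟩⟩ := exists_mulEquiv_prod B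
    (fun p => ∀ P : Sylow p B, IsCyclic P)
  have hcardB : Nat.card B = Nat.card C * Nat.card G₁ := by
    rw [Nat.card_congr f.toEquiv, Nat.card_prod]
  have hcop : (Nat.card C).Coprime (Nat.card G₁) :=
    Nat.coprime_of_dvd fun p hp h1 h2 => hG₁ p hp h2 (hC p hp h1)
  have hC2 : (Nat.card C).Coprime 2 := Nat.coprime_comm.mp ((Nat.Prime.coprime_iff_not_dvd
    Nat.prime_two).mpr fun h => h2B (hcardB ▸ h.mul_right _))
  have hG2 : (Nat.card G₁).Coprime 2 := Nat.coprime_comm.mp ((Nat.Prime.coprime_iff_not_dvd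
    Nat.prime_two).mpr fun h => h2B (hcardB ▸ h.mul_left _))
  have hCn : Group.IsNilpotent C := Group.nilpotent_of_surjective
    ((MonoidHom.fst C G₁).comp f.toMonoidHom) (Prod.fst_surjective.comp f.surjective)
  have hGn : Group.IsNilpotent G₁ := Group.nilpotent_of_surjective
    ((MonoidHom.snd C G₁).comp f.toMonoidHom) (Prod.snd_surjective.comp f.surjective)
  have hCz : IsZGroup C := ⟨fun p hp P => by
    have := Fact.mk hp
    by_cases hd : p ∣ Nat.card C
    · have hd' : ¬ p ∣ Nat.card G₁ := fun h => hG₁ p hp h (hC p hp hd)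
      obtain ⟨τ⟩ := nonempty_sylow_mulEquiv f hp hd' P default
      have := hC p hp hd default
      exact isCyclic_of_surjective τ.symm τ.symm.surjective
    · have := Sylow.card_eq_multiplicity P
      rw [Nat.factorization_eq_zero_of_not_dvd hd, pow_zero] at this
      have : Subsingleton P := (Nat.card_eq_one_iff_unique.mp this).1
      infer_instance⟩
  -- A finite nilpotent group with all Sylow subgroups cyclic is cyclic.
  have hCc : IsCyclic C := inferInstance
  let γ : Multiplicative (ZMod (Nat.card C)) ≃* C := zmodCyclicMulEquiv hCc
  let F : G ≃* G₁ × C × A := e.trans (MulEquiv.prodComm.trans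
    ((MulEquiv.prodCongr (f.trans MulEquiv.prodComm) (MulEquiv.refl A)).trans MulEquiv.prodAssoc))
  let F' : G ≃* G₁ × Multiplicative (ZMod (Nat.card C)) × GenQuaternion k :=
    F.trans (MulEquiv.prodCongr (MulEquiv.refl G₁) (MulEquiv.prodCongr γ.symm ε))
  rcases subsingleton_or_nontrivial G₁ with hsub | hnt
  · have : Unique G₁ := uniqueOfSubsingleton 1
    exact Or.inl ⟨Nat.card C, hC2, ⟨F'.trans MulEquiv.uniqueProd⟩⟩
  · refine Or.inr ⟨G₁, inferInstance, Nat.card C, ⟨inferInstance, hnt, hGn, ?_⟩, hcop.symm, hG2,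
      hC2, ⟨F'⟩⟩
    intro p hp hd P
    have := Fact.mk hp
    constructor
    · intro hPc
      refine hG₁ p hp hd fun Q => ?_
      have hd' : ¬ p ∣ Nat.card C := fun h => hG₁ p hp hd (hC p hp h)
      obtain ⟨τ⟩ := nonempty_sylow_mulEquiv (f.trans MulEquiv.prodComm) hp hd' P Q
      exact isCyclic_of_surjective τ τ.surjective
    -- A generalized quaternion Sylow subgroup would have even order, but `|G₁|` is odd.
    · rintro ⟨l, hl, ⟨τ⟩⟩
      have h1 : Nat.card P = 2 ^ l := by rw [Nat.card_congr τ.toEquiv, card_genQuaternion hl]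
      have h2 : 2 ∣ Nat.card G₁ :=
        (dvd_pow_self 2 (by omega)).trans (h1 ▸ Subgroup.card_subgroup_dvd_card (P : Subgroup G₁))
      exact absurd (Nat.dvd_gcd h2 dvd_rfl) (by rw [hG2]; norm_num)

/-- Coprimality of `n` to `2` also excludes `n = 0`, for which `ZMod n` is infinite. -/
theorem strongDominationNumber_of_mulEquiv_cyclic_prod {G : Type u} [Group G] {k n : ℕ}
    (hk : 3 ≤ k) (hn : n.Coprime 2) (e : G ≃* Multiplicative (ZMod n) × GenQuaternion k) :
    strongDominationNumber (properEnhancedPowerGraph G) = 2 ^ (k - 1) + 2 := by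
  have hcard : Nat.card (Multiplicative (ZMod n)) = n := Nat.card_zmod n
  rw [strongDominationNumber_congr e, strongDominationNumber_cyclic_prod_quaternion
    (two_le_two_pow_sub_two hk) (by rw [hcard]; exact coprime_card_genQuaternion hk hn),
    mul_add, ← pow_succ', show k - 2 + 1 = k - 1 by omega]

theorem strongDominationNumber_of_mulEquiv_noncyclic_prod {G : Type u} [Group G] {k n : ℕ}
    (hk : 3 ≤ k) {G₁ : Type v} [Group G₁] (hG : IsNoncyclicPart G₁)
    (hGn : (Nat.card G₁).Coprime n) (hG2 : (Nat.card G₁).Coprime 2) (hn : n.Coprime 2)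
    (e : G ≃* G₁ × Multiplicative (ZMod n) × GenQuaternion k) :
    strongDominationNumber (properEnhancedPowerGraph G) =
      min (minNumPrimeSubgroups G₁) (2 ^ (k - 2) + 1) + 1 := by
  have hcard : Nat.card (Multiplicative (ZMod n)) = n := Nat.card_zmod n
  rw [strongDominationNumber_congr e, strongDominationNumber_noncyclic_prod
    (two_le_two_pow_sub_two hk) hG hG2]
  · rw [Nat.card_prod, hcard]
    exact hGn.mul_right (coprime_card_genQuaternion hk hG2)
  · rw [hcard]; exact coprime_card_genQuaternion hk hn

end EnhancedPower

open EnhancedPower in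
theorem mainTheorem4 {G : Type u} [Group G] [Finite G] [Group.IsNilpotent G]
    (k : ℕ) (hk : 3 ≤ k) (S : Sylow 2 G) (hS : Nonempty (S ≃* GenQuaternion k)) :
    -- the cases below (with `n = 1` allowed) exhaust all such `G`
    ((∃ n : ℕ, Nat.Coprime n 2 ∧
        Nonempty (G ≃* Multiplicative (ZMod n) × GenQuaternion k)) ∨
      (∃ (G₁ : Type u) (_ : Group G₁) (n : ℕ), IsNoncyclicPart G₁ ∧
        Nat.Coprime (Nat.card G₁) n ∧ Nat.Coprime (Nat.card G₁) 2 ∧ Nat.Coprime n 2 ∧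
        Nonempty (G ≃* G₁ × Multiplicative (ZMod n) × GenQuaternion k))) ∧
    (Nonempty (G ≃* GenQuaternion k) →
      strongDominationNumber (properEnhancedPowerGraph G) = 2 ^ (k - 1) + 2) ∧
    (∀ n : ℕ, Nat.Coprime n 2 →
      Nonempty (G ≃* Multiplicative (ZMod n) × GenQuaternion k) →
      strongDominationNumber (properEnhancedPowerGraph G) = 2 ^ (k - 1) + 2) ∧
    (∀ (G₁ : Type v) [Group G₁], IsNoncyclicPart G₁ → Nat.Coprime (Nat.card G₁) 2 →
      Nonempty (G ≃* G₁ × GenQuaternion k) →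
      strongDominationNumber (properEnhancedPowerGraph G) =
        min (minNumPrimeSubgroups G₁) (2 ^ (k - 2) + 1) + 1) ∧
    (∀ (G₁ : Type v) [Group G₁] (n : ℕ), IsNoncyclicPart G₁ →
      Nat.Coprime (Nat.card G₁) n → Nat.Coprime (Nat.card G₁) 2 → Nat.Coprime n 2 →
      Nonempty (G ≃* G₁ × Multiplicative (ZMod n) × GenQuaternion k) →
      strongDominationNumber (properEnhancedPowerGraph G) =
        min (minNumPrimeSubgroups G₁) (2 ^ (k - 2) + 1) + 1) := by
  -- The cases without a cyclic factor are the cases `n = 1`.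
  let e₁ : GenQuaternion k ≃* Multiplicative (ZMod 1) × GenQuaternion k :=
    MulEquiv.uniqueProd.symm
  refine ⟨exists_decomposition S hS, ?_, ?_, ?_, ?_⟩
  · rintro ⟨e⟩
    exact strongDominationNumber_of_mulEquiv_cyclic_prod hk (Nat.coprime_one_left 2) (e.trans e₁)
  · rintro n hn ⟨e⟩
    exact strongDominationNumber_of_mulEquiv_cyclic_prod hk hn e
  · rintro G₁ _ hG hG2 ⟨e⟩
    exact strongDominationNumber_of_mulEquiv_noncyclic_prod hk hG (Nat.coprime_one_right _) hG2
      (Nat.coprime_one_left 2) (e.trans (MulEquiv.prodCongr (MulEquiv.refl G₁) e₁))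
  · rintro G₁ _ n hG hGn hG2 hn ⟨e⟩
    exact strongDominationNumber_of_mulEquiv_noncyclic_prod hk hG hGn hG2 hn e
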